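/- Fix $k,n\in\mathbb N=\{0,1,2,\dots\}$. Let $V_1,\dots,V_{k+1}$ be sets and $f:V_1\times\cdots\times V_{k+1}\to[0,1]$ a function. For $r<s$ in $[0,1]$, a box $A=A_1\times\cdots\times A_k$ with $A_i\subseteq V_i$ is $(r,s)$-shattered by $f$ if for every $S\subseteq A$ there is $c_S\in V_{k+1}$ such that $f(\bar a,c_S)\le r$ for all $\bar a\in S$ and $f(\bar a,c_S)\ge s$ for all $\bar a\in A\setminus S$. For a family $\bar d=(d_{r,s})_{r<s\in[0,1]}$ of natural numbers, write $\operatorname{VC}_k(f)\le\bar d$ if for all $r<s$ in $[0,1]$ no box $A_1\times\cdots\times A_k$ with $A_i\subseteq V_i$ and $|A_1|=\cdots=|A_k|=d_{r,s}$ is $(r,s)$-shattered by $f$. **Proposition.** Let $g:[0,1]^n\to[0,1]$ be a continuous function. For every family $\bar d=(d_{r,s})_{r<s\in[0,1]}$ of natural numbers there is a family $\bar D=(D_{r,s})_{r<s\in[0,1]}$ of natural numbers, depending only on $k$, $\bar d$ and $g$, such that the following holds. Let $V_1,\dots,V_{k+1}$ be arbitrary sets and let $f_1,\dots,f_n:V_1\times\cdots\times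 V_{k+1}\to[0,1]$ satisfy $\operatorname{VC}_k(f_j)\le\bar d$ for $j=1,\dots,n$. Then the function $h:=g(f_1,\dots,f_n):V_1\times\cdots\times V_{k+1}\to[0,1]$ satisfies $\operatorname{VC}_k(h)\le\bar D$. -/

import Mathlib

universe u

namespace VCk

/-- The box `A 0 × ⋯ × A (k-1)` (with `A i ⊆ V i`) is `(r, s)`-shattered by
`f : V 0 × ⋯ × V k → [0,1]`: for every subset `S` of the box there is `c` in the last
set `V k` with `f (a, c) ≤ r` for `a ∈ S` and `f (a, c) ≥ s` for `a` in the box outside `S`. -/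
def Shatters {k : ℕ} {V : Fin (k + 1) → Type u} (f : (∀ i, V i) → unitInterval)
    (r s : unitInterval) (A : ∀ i : Fin k, Set (V i.castSucc)) : Prop :=
  ∀ S : Set (∀ i : Fin k, V i.castSucc), S ⊆ Set.univ.pi A →
    ∃ c : V (Fin.last k),
      (∀ a ∈ S, f (Fin.snoc (α := V) a c) ≤ r) ∧
      (∀ a ∈ Set.univ.pi A \ S, s ≤ f (Fin.snoc (α := V) a c))

/-- `VC_k(f) ≤ d` at `(r, s)`: no box all of whose `k` sides have exactly `d` elements is
`(r, s)`-shattered by `f`. -/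
def DimLEAt {k : ℕ} {V : Fin (k + 1) → Type u} (f : (∀ i, V i) → unitInterval)
    (r s : unitInterval) (d : ℕ) : Prop :=
  ¬ ∃ A : ∀ i : Fin k, Finset (V i.castSucc),
    (∀ i, (A i).card = d) ∧ Shatters f r s (fun i => (A i : Set (V i.castSucc)))

/-- `VC_k(f) ≤ d̄` for a family `d̄ = (d r s)` of natural numbers indexed by `r < s` in `[0,1]`
(the values `d r s` with `s ≤ r` play no role). -/
def DimLE {k : ℕ} {V : Fin (k + 1) → Type u} (f : (∀ i, V i) → unitInterval)
    (d : unitInterval → unitInterval → ℕ) : Prop :=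
  ∀ r s : unitInterval, r < s → DimLEAt f r s (d r s)

end VCk

/-! Suppose `h` shatters a large box, with witnesses `c T`. Colour each pair (point `x`, subset `T`)
by the grid cells of all the values `f j (x, c T)`. The partite lemma (`exists_box_mono`), a
consequence of Hales–Jewett, gives a smaller box, with all its subsets, where incident pairs have
one colour `p` and non-incident pairs one colour `q`. As `g ≤ r` on the former and `g ≥ s` on the
latter, uniform continuity yields a `j` for which `p j` and `q j` are not adjacent
(`exists_grid_separating`). So `f j` shatters the smaller box across a whole grid interval. Only
finitely many such intervals exist, so one size contradicts all the bounds `d`. -/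

namespace VCk

/-- **Partite lemma** of Nešetřil and Rödl, for the edges of a relation `R`. -/
theorem exists_relation_mono_edges {ι X W κ : Type} [Finite ι] [Finite X] [Finite W] [Finite κ]
    (R : (ι → X) → W → Prop) :
    ∃ (Y Z : Type) (_ : Finite Y) (_ : Finite Z) (R' : (ι → Y) → Z → Prop),
      ∀ C : (ι → Y) → Z → κ, ∃ (φ : ι → X → Y) (ψ : W → Z),
        (∀ i, Function.Injective (φ i)) ∧
        (∀ x w, R' (fun i => φ i (x i)) (ψ w) ↔ R x w) ∧
        ∃ c, ∀ x w, R x w → C (fun i => φ i (x i)) (ψ w) = c := by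
  -- Hales–Jewett with the edges of `R` as alphabet; a word is then an edge of the coordinatewise
  -- power of `R`.
  obtain ⟨M, _, hM⟩ := Combinatorics.Line.exists_mono_in_high_dimension
    {p : (ι → X) × W // R p.1 p.2} κ
  refine ⟨M → X, M → W, inferInstance, inferInstance,
    fun y z => ∀ m, R (fun i => y i m) (z m), fun C => ?_⟩
  obtain ⟨l, c, hl⟩ := hM fun v => C (fun i m => (v m).1.1 i) (fun m => (v m).1.2)
  obtain ⟨m₀, hm₀⟩ := l.proper
  -- Active coordinates of the line carry the argument and fixed ones carry a constant edge, so only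
  -- the active ones test `R x w`.
  refine ⟨fun i x m => (l.idxFun m).elim x (fun e => e.1.1 i),
    fun w m => (l.idxFun m).elim w (fun e => e.1.2), fun i x x' h => ?_, fun x w => ⟨fun h => ?_,
    fun h m => ?_⟩, c, fun x w h => ?_⟩
  · simpa [hm₀] using congrFun h m₀
  · simpa [hm₀] using h m₀
  · cases hm : l.idxFun m with
    | none => simpa [hm] using h
    | some e => simpa [hm] using e.2
  · rw [← hl ⟨(x, w), h⟩]
    congr 1
    · funext i m
      cases hm : l.idxFun m <;> simp [hm]
    · funext m
      cases hm : l.idxFun m <;> simp [hm]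

/-- Partite lemma, for the edges and the non-edges of a relation `R` simultaneously. -/
theorem exists_relation_mono {ι X W κ : Type} [Finite ι] [Finite X] [Finite W] [Finite κ]
    (R : (ι → X) → W → Prop) :
    ∃ (Y Z : Type) (_ : Finite Y) (_ : Finite Z) (R' : (ι → Y) → Z → Prop),
      ∀ C : (ι → Y) → Z → κ, ∃ (φ : ι → X → Y) (ψ : W → Z),
        (∀ i, Function.Injective (φ i)) ∧
        (∀ x w, R' (fun i => φ i (x i)) (ψ w) ↔ R x w) ∧
        (∃ c, ∀ x w, R x w → C (fun i => φ i (x i)) (ψ w) = c) ∧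
        ∃ c, ∀ x w, ¬ R x w → C (fun i => φ i (x i)) (ψ w) = c := by
  obtain ⟨Y₁, Z₁, _, _, R₁, h₁⟩ := exists_relation_mono_edges (κ := κ) R
  -- The outer step fixes the colour of the non-edges of `R₁`. Non-edges of `R` land there, so the
  -- inner step keeps this.
  obtain ⟨Y₂, Z₂, _, _, R₂, h₂⟩ := exists_relation_mono_edges (κ := κ) fun y z => ¬ R₁ y z
  refine ⟨Y₂, Z₂, inferInstance, inferInstance, fun y z => ¬ R₂ y z, fun C => ?_⟩
  obtain ⟨φ₂, ψ₂, hφ₂, hR₂, c₂, hc₂⟩ := h₂ C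
  obtain ⟨φ₁, ψ₁, hφ₁, hR₁, c₁, hc₁⟩ := h₁ fun y z => C (fun i => φ₂ i (y i)) (ψ₂ z)
  refine ⟨fun i x => φ₂ i (φ₁ i x), fun w => ψ₂ (ψ₁ w), fun i => (hφ₂ i).comp (hφ₁ i),
    fun x w => ?_, ⟨c₁, hc₁⟩, c₂, fun x w h => hc₂ (fun i => φ₁ i (x i)) (ψ₁ w) ?_⟩
  · change ¬ R₂ (fun i => φ₂ i (φ₁ i (x i))) (ψ₂ (ψ₁ w)) ↔ _
    rw [hR₂ (fun i => φ₁ i (x i)) (ψ₁ w), not_not, hR₁]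
  · rwa [hR₁]

/-- Any finite colouring of the pairs (point, subset) of a large box is constant on the incident
pairs, and on the non-incident pairs, of a copy of the structure of all subsets of a small box. -/
theorem exists_box_mono (k d : ℕ) (κ : Type) [Finite κ] :
    ∃ D : ℕ, ∀ C : (Fin k → Fin D) → Set (Fin k → Fin D) → κ,
      ∃ (φ : Fin k → Fin d → Fin D) (ψ : Set (Fin k → Fin d) → Set (Fin k → Fin D)),
        (∀ i, Function.Injective (φ i)) ∧
        (∀ x S, (fun i => φ i (x i)) ∈ ψ S ↔ x ∈ S) ∧
        (∃ c, ∀ x S, x ∈ S → C (fun i => φ i (x i)) (ψ S) = c) ∧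
        ∃ c, ∀ x S, x ∉ S → C (fun i => φ i (x i)) (ψ S) = c := by
  obtain ⟨Y, Z, _, _, R, h⟩ := exists_relation_mono (κ := κ)
    fun (x : Fin k → Fin d) (S : Set (Fin k → Fin d)) => x ∈ S
  let e := Finite.equivFin Y
  let T : Z → Set (Fin k → Fin (Nat.card Y)) := fun z => {y | R (fun i => e.symm (y i)) z}
  refine ⟨Nat.card Y, fun C => ?_⟩
  obtain ⟨φ, ψ, hφ, hR, hc⟩ := h fun y z => C (fun i => e (y i)) (T z)
  refine ⟨fun i x => e (φ i x), fun S => T (ψ S), fun i => e.injective.comp (hφ i),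
    fun x S => ?_, hc⟩
  simpa [T] using hR x S

section Parametrization

variable {k : ℕ} {V : Fin (k + 1) → Type u} {f : (∀ i, V i) → unitInterval} {r s : unitInterval}

theorem not_dimLEAt_of_injective {d m : ℕ} (hdm : d ≤ m) (e : ∀ i : Fin k, Fin m → V i.castSucc)
    (he : ∀ i, Function.Injective (e i))
    (h : ∀ T : Set (Fin k → Fin m), ∃ c : V (Fin.last k),
      (∀ x ∈ T, f (Fin.snoc (α := V) (fun i => e i (x i)) c) ≤ r) ∧
      ∀ x ∉ T, s ≤ f (Fin.snoc (α := V) (fun i => e i (x i)) c)) :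
    ¬ DimLEAt f r s d := by
  classical
  refine not_not_intro ⟨fun i => Finset.univ.image fun t : Fin d => e i (Fin.castLE hdm t),
    fun i => ?_, fun S hS => ?_⟩
  · exact (Finset.card_image_of_injective _ ((he i).comp (Fin.castLE_injective hdm))).trans
      (Finset.card_fin d)
  · have key : ∀ a ∈ Set.univ.pi fun i : Fin k =>
        ((Finset.univ.image fun t : Fin d => e i (Fin.castLE hdm t) : Finset (V i.castSucc)) :
          Set (V i.castSucc)), ∃ x : Fin k → Fin m, (fun i => e i (x i)) = a := by
      intro a ha
      have hx : ∀ i, ∃ t : Fin d, e i (Fin.castLE hdm t) = a i := fun i => by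
        simpa using ha i (Set.mem_univ i)
      choose x hx using hx
      exact ⟨fun i => Fin.castLE hdm (x i), funext hx⟩
    obtain ⟨c, h₁, h₂⟩ := h {x | (fun i => e i (x i)) ∈ S}
    refine ⟨c, fun a ha => ?_, fun a ha => ?_⟩
    · obtain ⟨x, rfl⟩ := key a (hS ha)
      exact h₁ x ha
    · obtain ⟨x, rfl⟩ := key a ha.1
      exact h₂ x ha.2

theorem exists_injective_of_not_dimLEAt {D : ℕ} (h : ¬ DimLEAt f r s D) :
    ∃ e : ∀ i : Fin k, Fin D → V i.castSucc, (∀ i, Function.Injective (e i)) ∧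
      ∀ T : Set (Fin k → Fin D), ∃ c : V (Fin.last k),
        (∀ x ∈ T, f (Fin.snoc (α := V) (fun i => e i (x i)) c) ≤ r) ∧
        ∀ x ∉ T, s ≤ f (Fin.snoc (α := V) (fun i => e i (x i)) c) := by
  obtain ⟨A, hA, hS⟩ := not_not.1 h
  let e : ∀ i : Fin k, Fin D → V i.castSucc :=
    fun i t => ((A i).equivFinOfCardEq (hA i)).symm t
  have he : ∀ i, Function.Injective (e i) := fun i =>
    Subtype.val_injective.comp (Equiv.injective _)
  have hmem : ∀ x : Fin k → Fin D, (fun i => e i (x i)) ∈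
      Set.univ.pi fun i : Fin k => (A i : Set (V i.castSucc)) :=
    fun x i _ => Finset.coe_mem _
  refine ⟨e, he, fun T => ?_⟩
  obtain ⟨c, h₁, h₂⟩ := hS ((fun (x : Fin k → Fin D) i => e i (x i)) '' T) (by
    rintro _ ⟨x, -, rfl⟩
    exact hmem x)
  refine ⟨c, fun x hx => h₁ _ ⟨x, hx, rfl⟩, fun x hx => h₂ _ ⟨hmem x, ?_⟩⟩
  rintro ⟨y, hy, hxy⟩
  exact hx ((funext fun i => he i (congrFun hxy i) : y = x) ▸ hy)

end Parametrization

/-- The index of the cell `[i / N, (i + 1) / N)` that contains `t`. -/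
noncomputable def cell (N : ℕ) (t : unitInterval) : Fin (N + 1) :=
  ⟨⌊(t : ℝ) * N⌋₊, Nat.lt_succ_of_le (Nat.floor_le_of_le
    (mul_le_of_le_one_left N.cast_nonneg t.2.2))⟩

/-- The grid point `i / N`, clipped to the unit interval. -/
noncomputable def gridPoint (N i : ℕ) : unitInterval :=
  Set.projIcc 0 1 zero_le_one ((i : ℝ) / N)

theorem coe_gridPoint {N i : ℕ} (h : i ≤ N) : (gridPoint N i : ℝ) = i / N := by
  have hi : (i : ℝ) / N ∈ Set.Icc (0 : ℝ) 1 :=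
    ⟨by positivity, div_le_one_of_le₀ (by exact_mod_cast h) N.cast_nonneg⟩
  rw [gridPoint, Set.projIcc_of_mem _ hi]

theorem gridPoint_le_of_le_cell {N i : ℕ} (hN : 0 < N) {t : unitInterval}
    (h : i ≤ (cell N t : ℕ)) : gridPoint N i ≤ t := by
  rw [← Subtype.coe_le_coe, coe_gridPoint (h.trans (Nat.lt_succ_iff.1 (cell N t).2)),
    div_le_iff₀ (by exact_mod_cast hN)]
  exact (Nat.le_floor_iff (mul_nonneg t.2.1 N.cast_nonneg)).1 h

theorem le_gridPoint_of_cell_lt {N i : ℕ} (hi : i ≤ N) {t : unitInterval}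
    (h : (cell N t : ℕ) < i) : t ≤ gridPoint N i := by
  have hN : 0 < N := by omega
  rw [← Subtype.coe_le_coe, coe_gridPoint hi, le_div_iff₀ (by exact_mod_cast hN)]
  exact ((Nat.floor_lt (mul_nonneg t.2.1 N.cast_nonneg)).1 h).le

theorem gridPoint_lt_gridPoint {N i j : ℕ} (hij : i < j) (hj : j ≤ N) :
    gridPoint N i < gridPoint N j := by
  have hN : (0 : ℝ) < N := by exact_mod_cast (by omega : 0 < N)
  rw [← Subtype.coe_lt_coe, coe_gridPoint (hij.le.trans hj), coe_gridPoint hj]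
  gcongr

theorem dist_lt_of_cell_le {N : ℕ} (hN : 0 < N) {t u : unitInterval}
    (h₁ : (cell N t : ℕ) ≤ cell N u + 1) (h₂ : (cell N u : ℕ) ≤ cell N t + 1) :
    dist t u < 2 / N := by
  have hN' : (0 : ℝ) < N := by exact_mod_cast hN
  have ht₁ : ((cell N t : ℕ) : ℝ) ≤ t * N := Nat.floor_le (mul_nonneg t.2.1 hN'.le)
  have hu₁ : ((cell N u : ℕ) : ℝ) ≤ u * N := Nat.floor_le (mul_nonneg u.2.1 hN'.le)
  have ht₂ : (t : ℝ) * N < (cell N t : ℕ) + 1 := Nat.lt_floor_add_one _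
  have hu₂ : (u : ℝ) * N < (cell N u : ℕ) + 1 := Nat.lt_floor_add_one _
  have h₁' : ((cell N t : ℕ) : ℝ) ≤ (cell N u : ℕ) + 1 := by exact_mod_cast h₁
  have h₂' : ((cell N u : ℕ) : ℝ) ≤ (cell N t : ℕ) + 1 := by exact_mod_cast h₂
  rw [Subtype.dist_eq, Real.dist_eq, lt_div_iff₀ hN', ← abs_of_pos hN', ← abs_mul, abs_lt]
  constructor <;> linarith

/-- If `g` separates two points by `s - r`, some coordinate separates their cells. -/
theorem exists_grid_separating {n : ℕ} {g : (Fin n → unitInterval) → unitInterval}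
    (hg : Continuous g) {r s : unitInterval} (hrs : r < s) :
    ∃ N : ℕ, 0 < N ∧ ∀ p q : Fin n → unitInterval, g p ≤ r → s ≤ g q →
      ∃ j, (cell N (p j) : ℕ) + 1 < cell N (q j) ∨ (cell N (q j) : ℕ) + 1 < cell N (p j) := by
  obtain ⟨δ, hδ, hgδ⟩ := Metric.uniformContinuous_iff.1
    (CompactSpace.uniformContinuous_of_continuous hg) (s - r : ℝ) (sub_pos.2 hrs)
  -- Values in equal or adjacent cells differ by less than `2 / N < δ`.
  obtain ⟨N, hN⟩ := exists_nat_gt (2 / δ)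
  have hN₀ : (0 : ℝ) < N := (by positivity : (0 : ℝ) < 2 / δ).trans hN
  refine ⟨N, by exact_mod_cast hN₀, fun p q hp hq => ?_⟩
  by_contra! hj
  have hpq : dist p q < δ := (dist_pi_lt_iff hδ).2 fun j =>
    (dist_lt_of_cell_le (by exact_mod_cast hN₀) (hj j).2 (hj j).1).trans
      ((div_lt_comm₀ hδ hN₀).1 hN)
  have h := hgδ hpq
  rw [dist_comm, Subtype.dist_eq, Real.dist_eq] at h
  have h' := (le_abs_self _).trans_lt h
  have hp' : (g p : ℝ) ≤ r := hp
  have hq' : (s : ℝ) ≤ g q := hq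
  linarith

theorem exists_dimLEAt_comp (k : ℕ) {n : ℕ} {g : (Fin n → unitInterval) → unitInterval}
    (hg : Continuous g) (d : unitInterval → unitInterval → ℕ) {r s : unitInterval} (hrs : r < s) :
    ∃ D : ℕ, ∀ (V : Fin (k + 1) → Type u) (f : Fin n → (∀ i, V i) → unitInterval),
      (∀ j, DimLE (f j) d) → DimLEAt (fun x => g fun j => f j x) r s D := by
  obtain ⟨N, hN, hsep⟩ := exists_grid_separating hg hrs
  -- The `+ 1` keeps `Fin m` nonempty, so that `x₀` below exists and both colours are attained.
  let m := (Finset.range N).sup (fun i => d (gridPoint N i) (gridPoint N (i + 1))) + 1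
  have hm : ∀ i < N, d (gridPoint N i) (gridPoint N (i + 1)) ≤ m := fun i hi =>
    (Finset.le_sup (f := fun i => d (gridPoint N i) (gridPoint N (i + 1)))
      (Finset.mem_range.2 hi)).trans (Nat.le_succ _)
  obtain ⟨D, hD⟩ := exists_box_mono k m (Fin n → Fin (N + 1))
  refine ⟨D, fun V f hf => ?_⟩
  by_contra hcon
  obtain ⟨e, he, hc⟩ := exists_injective_of_not_dimLEAt hcon
  choose c hle hge using hc
  obtain ⟨φ, ψ, hφ, hψ, ⟨p, hp⟩, q, hq⟩ :=
    hD fun x T j => cell N (f j (Fin.snoc (α := V) (fun i => e i (x i)) (c T)))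
  have he' : ∀ i, Function.Injective fun t => e i (φ i t) := fun i => (he i).comp (hφ i)
  let x₀ : Fin k → Fin m := fun _ => 0
  obtain ⟨j, hj⟩ := hsep _ _ (hle (ψ {x₀}) _ ((hψ x₀ {x₀}).2 rfl))
    (hge (ψ ∅) _ (mt (hψ x₀ ∅).1 (Set.notMem_empty x₀)))
  have hp' := fun x S hx => congrFun (hp x S hx) j
  have hq' := fun x S hx => congrFun (hq x S hx) j
  simp only at hp' hq'
  rw [hp' x₀ {x₀} rfl, hq' x₀ ∅ (Set.notMem_empty x₀)] at hj
  rcases hj with hj | hj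
  · have hjN := (q j).2
    -- The gap of at least two cells leaves the interval from `p j + 1` to `p j + 2` free.
    refine not_dimLEAt_of_injective (hm (p j + 1) (by omega)) _ he' (fun T =>
      ⟨c (ψ T), fun x hx => le_gridPoint_of_cell_lt (by omega) ?_,
        fun x hx => gridPoint_le_of_le_cell hN ?_⟩)
      (hf j _ _ (gridPoint_lt_gridPoint (Nat.lt_succ_self _) (by omega)))
    · rw [hp' x T hx]
      omega
    · rw [hq' x T hx]
      omega
  · have hjN := (p j).2
    -- Here `f j` is small off the chosen set, so the witness for `T` comes from `Tᶜ`.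
    refine not_dimLEAt_of_injective (hm (q j + 1) (by omega)) _ he' (fun T =>
      ⟨c (ψ Tᶜ), fun x hx => le_gridPoint_of_cell_lt (by omega) ?_,
        fun x hx => gridPoint_le_of_le_cell hN ?_⟩)
      (hf j _ _ (gridPoint_lt_gridPoint (Nat.lt_succ_self _) (by omega)))
    · rw [hq' x Tᶜ (not_not_intro hx)]
      omega
    · rw [hp' x Tᶜ hx]
      omega

end VCk

theorem mainTheorem9 (k n : ℕ) (g : (Fin n → unitInterval) → unitInterval) (hg : Continuous g)
    (d : unitInterval → unitInterval → ℕ) :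
    ∃ D : unitInterval → unitInterval → ℕ,
      ∀ (V : Fin (k + 1) → Type u) (f : Fin n → (∀ i, V i) → unitInterval),
        (∀ j, VCk.DimLE (f j) d) → VCk.DimLE (fun x => g (fun j => f j x)) D := by
  have h : ∀ r s : unitInterval, ∃ D : ℕ, r < s →
      ∀ (V : Fin (k + 1) → Type u) (f : Fin n → (∀ i, V i) → unitInterval),
        (∀ j, VCk.DimLE (f j) d) → VCk.DimLEAt (fun x => g fun j => f j x) r s D := by
    intro r s
    by_cases hrs : r < s
    · obtain ⟨D, hD⟩ := VCk.exists_dimLEAt_comp k hg d hrs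
      exact ⟨D, fun _ => hD⟩
    · exact ⟨0, fun h => absurd h hrs⟩
  choose D hD using h
  exact ⟨D, fun V f hf r s hrs => hD r s hrs V f hf⟩
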